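/- Let $n\ge 2$ and let $\mathcal{BT}_n$ be the boxed threshold arrangement in $\mathbb{R}^n$, consisting of the hyperplanes $x_i+x_j=1$ for $1\le i<j\le n$ and $x_i=0$, $x_i=1$ for $1\le i\le n$. A region of $\mathcal{BT}_n$ is a connected component of the complement in $\mathbb{R}^n$ of the union of these hyperplanes. Then the number of regions of $\mathcal{BT}_n$ is finite and equal to $$4\,a(n)+\sum_{k=1}^{n}4\,\bigl(k!-(k-1)!\bigr)\bigl(k\,S(n,k)-n\,S(n-1,k-1)\bigr),$$ where $a(n)$ is the $n$-th ordered Bell number, i.e. the number of ordered partitions of an $n$-element set into nonempty blocks, and $S(m,k)$ is the Stirling number of the second kind, i.e. the number of partitions of an $m$-element set into $k$ nonempty blocks. -/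

import Mathlib

/-- The boxed threshold arrangement `BT_n` in `ℝⁿ`: the hyperplanes `x_i + x_j = 1` for `i < j`,
together with `x_i = 0` and `x_i = 1` for every `i`. -/
def boxedThresholdArrangement (n : ℕ) : Set (Set (Fin n → ℝ)) :=
  {H | ∃ i j : Fin n, i < j ∧ H = {x | x i + x j = 1}} ∪
    {H | ∃ i : Fin n, H = {x | x i = 0} ∨ H = {x | x i = 1}}

/-- The regions of a collection of hyperplanes in `ℝⁿ`: the connected components of the complement
of its union. -/
def arrangementRegions {n : ℕ} (A : Set (Set (Fin n → ℝ))) : Set (Set (Fin n → ℝ)) :=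
  {R | ∃ x ∈ (⋃₀ A)ᶜ, R = connectedComponentIn (⋃₀ A)ᶜ x}

/-- An ordered partition of an `n`-element set into `k` blocks: a sequence `B_1, …, B_k` of
nonempty, pairwise disjoint subsets that cover the set. -/
def IsOrderedSetPartition {n k : ℕ} (B : Fin k → Finset (Fin n)) : Prop :=
  (∀ i, (B i).Nonempty) ∧ (∀ i j, i ≠ j → Disjoint (B i) (B j)) ∧ ∀ a, ∃ i, a ∈ B i

/-- The `n`-th ordered Bell number: the number of ordered partitions of an `n`-element set
(such a partition has at most `n` blocks). -/
noncomputable def orderedBell (n : ℕ) : ℕ :=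
  ∑ k ∈ Finset.range (n + 1), Nat.card {B : Fin k → Finset (Fin n) // IsOrderedSetPartition B}

/-!
After the substitution `u = 2 x - 1` the hyperplanes become `u i + u j = 0` and `u i = ±1`. The
region of `u` is determined by the signs of the coordinates, by which of two coordinates of opposite
sign has the larger absolute value, and by the comparison of each absolute value with the threshold
`1`. Group the coordinates by
increasing absolute value into levels, where a new level starts exactly when the sign changes or the
threshold is crossed. This turns `u` into a surjection onto `k` levels, a position `c` of the
threshold among them, and a starting sign on each side of the threshold, the signs alternating from
level to level.

The code is unique up to one ambiguity: if there is a coordinate of smallest absolute value below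
the threshold, its sign is not seen by any hyperplane. When another coordinate lies below the
threshold, the smallest one can be moved onto the next, so level `0` may be taken to have at least
two elements; when it is alone, it may be taken to be positive. With these normalisations
(`IsAdmissible`) regions correspond bijectively to codes. Existence of the code is
`RegionCode.exists_represents`, uniqueness is `RegionCode.eq_of_represents`, and
`connectedComponentIn_eq_iff_sameSide` identifies regions with the sign patterns of the hyperplanes.

A surjection whose fibre over level `0` is a singleton carries `4` codes, any other one carries
`4 * k` (`card_isAdmissible`). There are `k! * S(n, k)` surjections, `n * (k - 1)! * S(n - 1, k - 1)`
of which have a singleton over `0`. Hence the number of codes with `k` levels is four times the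
number of ordered partitions into `k` blocks plus `4 * (k - 1)` times the number
`(k - 1)! * (k * S(n, k) - n * S(n - 1, k - 1))` of those whose first block is not a singleton.
-/

open Function

/-! ### Surjections and ordered partitions -/

/-- A surjection of `Fin (n + 1)` is determined by its value at `0` and its tail, which either is
surjective or misses exactly that value. -/
theorem Nat.card_surjective_fin_succ (n k : ℕ) :
    Nat.card {f : Fin (n + 1) → Fin (k + 1) // Surjective f} =
      (k + 1) * (Nat.card {f : Fin n → Fin (k + 1) // Surjective f} +
        Nat.card {f : Fin n → Fin k // Surjective f}) := by
  classical
  let F : Fin (k + 1) × ({f : Fin n → Fin (k + 1) // Surjective f} ⊕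
      {f : Fin n → Fin k // Surjective f}) → {f : Fin (n + 1) → Fin (k + 1) // Surjective f} :=
    fun p => match p with
      | (a, Sum.inl g) => ⟨Fin.cons a g.1, fun b => by
          obtain ⟨i, hi⟩ := g.2 b
          exact ⟨i.succ, by simpa using hi⟩⟩
      | (a, Sum.inr h) => ⟨Fin.cons a (a.succAbove ∘ h.1), fun b => by
          by_cases hb : b = a
          · exact ⟨0, by simp [hb]⟩
          · obtain ⟨b', rfl⟩ := Fin.exists_succAbove_eq hb
            obtain ⟨i, rfl⟩ := h.2 b'
            exact ⟨i.succ, by simp⟩⟩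
  have hF : Bijective F := by
    constructor
    · rintro ⟨a, g | g⟩ ⟨b, h | h⟩ hab
      · obtain ⟨rfl, hgh⟩ := Fin.cons_inj.1
          (show (Fin.cons a g.1 : Fin (n + 1) → Fin (k + 1)) = Fin.cons b h.1 from
          congrArg Subtype.val hab)
        rw [Subtype.ext hgh]
      · obtain ⟨rfl, hgh⟩ := Fin.cons_inj.1
          (show (Fin.cons a g.1 : Fin (n + 1) → Fin (k + 1)) =
          Fin.cons b (b.succAbove ∘ h.1) from congrArg Subtype.val hab)
        obtain ⟨i, hi⟩ := g.2 a
        exact absurd (hi ▸ (congrFun hgh i).symm) (Fin.succAbove_ne a _)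
      · obtain ⟨rfl, hgh⟩ := Fin.cons_inj.1
          (show (Fin.cons a (a.succAbove ∘ g.1) : Fin (n + 1) → Fin (k + 1)) =
          Fin.cons b h.1 from congrArg Subtype.val hab)
        obtain ⟨i, hi⟩ := h.2 a
        exact absurd (hi ▸ (congrFun hgh i)) (Fin.succAbove_ne a _)
      · obtain ⟨rfl, hgh⟩ := Fin.cons_inj.1
          (show (Fin.cons a (a.succAbove ∘ g.1) : Fin (n + 1) → Fin (k + 1)) =
          Fin.cons b (b.succAbove ∘ h.1) from congrArg Subtype.val hab)
        rw [Subtype.ext ((Fin.succAbove_right_injective (p := a)).comp_left hgh)]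
    · rintro ⟨f, hf⟩
      by_cases hs : Surjective (Fin.tail f)
      · exact ⟨(f 0, Sum.inl ⟨Fin.tail f, hs⟩), Subtype.ext (Fin.cons_self_tail f)⟩
      · -- the tail misses some value, which can only be `f 0`
        have hne : ∀ i, Fin.tail f i ≠ f 0 := by
          intro i hi
          refine hs fun b => ?_
          obtain ⟨j, hj⟩ := hf b
          induction j using Fin.cases with
          | zero => exact ⟨i, hi.trans hj⟩
          | succ j => exact ⟨j, hj⟩
        choose g hg using fun i => Fin.exists_succAbove_eq (hne i)
        refine ⟨(f 0, Sum.inr ⟨g, fun b => ?_⟩), Subtype.ext ?_⟩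
        · obtain ⟨j, hj⟩ := hf ((f 0).succAbove b)
          induction j using Fin.cases with
          | zero => exact absurd hj.symm (Fin.succAbove_ne _ _)
          | succ j => exact ⟨j, Fin.succAbove_right_injective ((hg j).trans hj)⟩
        · have : (f 0).succAbove ∘ g = Fin.tail f := funext hg
          simp only [F, this, Fin.cons_self_tail]
  rw [← Nat.card_eq_of_bijective F hF, Nat.card_prod, Nat.card_sum, Nat.card_fin]

theorem Nat.card_surjective_fin (n k : ℕ) :
    Nat.card {f : Fin n → Fin k // Surjective f} = k.factorial * n.stirlingSecond k := by
  induction n generalizing k with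
  | zero =>
    cases k with
    | zero =>
      have : Nonempty {f : Fin 0 → Fin 0 // Surjective f} := ⟨⟨id, surjective_id⟩⟩
      rw [Nat.card_eq_one_iff_unique.2 ⟨inferInstance, this⟩]
      simp
    | succ k =>
      have : IsEmpty {f : Fin 0 → Fin (k + 1) // Surjective f} :=
        ⟨fun f => (f.2 0).choose.elim0⟩
      simp
  | succ n ih =>
    cases k with
    | zero =>
      have : IsEmpty {f : Fin (n + 1) → Fin 0 // Surjective f} := ⟨fun f => (f.1 0).elim0⟩
      simp
    | succ k =>
      rw [Nat.card_surjective_fin_succ, ih, ih, Nat.stirlingSecond_succ_succ, Nat.factorial_succ]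
      ring

/-- Surjections onto `Fin (k + 1)` whose fibre over `0` is a single point are obtained by choosing
that point and a surjection of the remaining points onto the remaining values. -/
theorem Nat.card_surjective_fin_existsUnique_zero (n k : ℕ) :
    Nat.card {f : {f : Fin (n + 1) → Fin (k + 1) // Surjective f} // ∃! i, (f.1 i : ℕ) = 0} =
      (n + 1) * Nat.card {f : Fin n → Fin k // Surjective f} := by
  let F : Fin (n + 1) × {f : Fin n → Fin k // Surjective f} →
      {f : {f : Fin (n + 1) → Fin (k + 1) // Surjective f} // ∃! i, (f.1 i : ℕ) = 0} :=
    fun p => ⟨⟨p.1.insertNth (α := fun _ => Fin (k + 1)) 0 (Fin.succ ∘ p.2.1), fun b => by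
        induction b using Fin.cases with
        | zero => exact ⟨p.1, by simp⟩
        | succ b =>
          obtain ⟨i, rfl⟩ := p.2.2 b
          exact ⟨p.1.succAbove i, by simp⟩⟩,
      p.1, by simp, fun j hj => by
        by_contra hne
        obtain ⟨j, rfl⟩ := Fin.exists_succAbove_eq hne
        simp at hj⟩
  have hF : Bijective F := by
    constructor
    · rintro ⟨a, g⟩ ⟨b, h⟩ hab
      have hfun := congrArg (fun f => f.1.1) hab
      simp only [F] at hfun
      have hba : a = b := by
        by_contra hne
        obtain ⟨j, hj⟩ := Fin.exists_succAbove_eq hne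
        have h0 := congrFun hfun a
        rw [Fin.insertNth_apply_same, ← hj, Fin.insertNth_apply_succAbove] at h0
        exact Fin.succ_ne_zero _ h0.symm
      subst hba
      have hgh : g = h := Subtype.ext <| funext fun i => by
        have := congrFun hfun (a.succAbove i)
        simpa using this
      rw [hgh]
    · rintro ⟨⟨f, hf⟩, a, ha, huniq⟩
      have ha0 : f a = 0 := Fin.ext ha
      have hne : ∀ i, f (a.succAbove i) ≠ 0 := fun i hi =>
        Fin.succAbove_ne a i (huniq _ (by simp [hi]))
      choose g hg using fun i => Fin.exists_succ_eq.2 (hne i)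
      refine ⟨(a, ⟨g, fun b => ?_⟩), Subtype.ext (Subtype.ext (funext fun j => ?_))⟩
      · obtain ⟨j, hj⟩ := hf b.succ
        have hja : j ≠ a := by
          rintro rfl
          exact Fin.succ_ne_zero b (hj.symm.trans ha0)
        obtain ⟨i, rfl⟩ := Fin.exists_succAbove_eq hja
        exact ⟨i, Fin.succ_injective _ ((hg i).trans hj)⟩
      · induction j using a.succAboveCases with
        | x => simp [F, ha0]
        | p i => simp [F, hg]
  rw [← Nat.card_eq_of_bijective F hF, Nat.card_prod, Nat.card_fin]

/-- The sequence of blocks `B` corresponds to the function sending an element to the index of its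
block. -/
theorem Nat.card_isOrderedSetPartition (n k : ℕ) :
    Nat.card {B : Fin k → Finset (Fin n) // IsOrderedSetPartition B} =
      Nat.card {f : Fin n → Fin k // Surjective f} := by
  classical
  let F : {f : Fin n → Fin k // Surjective f} →
      {B : Fin k → Finset (Fin n) // IsOrderedSetPartition B} :=
    fun f => ⟨fun b => Finset.univ.filter fun i => f.1 i = b,
      fun b => by
        obtain ⟨i, hi⟩ := f.2 b
        exact ⟨i, by simpa using hi⟩,
      fun a b hab => Finset.disjoint_left.2 fun i hi hj => by
        simp only [Finset.mem_filter, Finset.mem_univ, true_and] at hi hj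
        exact hab (hi.symm.trans hj),
      fun i => ⟨f.1 i, by simp⟩⟩
  refine (Nat.card_eq_of_bijective F ⟨fun f g hfg => ?_, ?_⟩).symm
  · refine Subtype.ext (funext fun i => ?_)
    have h : i ∈ (F g).1 (f.1 i) := by
      rw [← hfg]
      simp [F]
    simpa [F, eq_comm] using h
  · rintro ⟨B, hne, hdisj, hcov⟩
    choose f hf using id hcov
    have huniq : ∀ i b, i ∈ B b → f i = b := fun i b hb => by
      by_contra h
      exact Finset.disjoint_left.1 (hdisj _ _ h) (hf i) hb
    refine ⟨⟨f, fun b => (hne b).imp fun i hi => huniq i b hi⟩, Subtype.ext (funext fun b => ?_)⟩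
    ext i
    simp only [F, Finset.mem_filter, Finset.mem_univ, true_and]
    exact ⟨fun h => h ▸ hf i, huniq i b⟩

/-! ### Counting codes -/

/-- Compatibility of the position `c` of the threshold among `k` levels with the signs `e.1` below
and `e.2` above it. A sign with no level on its side is normalised to `true`. The proposition
`single` says that level `0` consists of one coordinate. If that coordinate is below the threshold,
its sign is not determined by the region, so this is only allowed when no other coordinate is below
the threshold, and then the sign is normalised to `true`. -/
def IsAdmissible {k : ℕ} (single : Prop) (t : Fin (k + 1) × Bool × Bool) : Prop :=
  ((t.1 : ℕ) = 0 → t.2.1 = true) ∧ ((t.1 : ℕ) = k → t.2.2 = true) ∧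
    (single → (t.1 : ℕ) ≤ 1 ∧ ((t.1 : ℕ) = 1 → t.2.1 = true))

open Classical in
theorem card_isAdmissible {k : ℕ} (hk : 1 ≤ k) (single : Prop) (h : single → 2 ≤ k) :
    Nat.card {t : Fin (k + 1) × Bool × Bool // IsAdmissible single t} =
      if single then 4 else 4 * k := by
  have key : Nat.card {t : Fin (k + 1) × Bool × Bool // IsAdmissible single t} =
      ∑ c : Fin (k + 1), ((if IsAdmissible single (c, true, true) then 1 else 0) +
        (if IsAdmissible single (c, true, false) then 1 else 0) +
        (if IsAdmissible single (c, false, true) then 1 else 0) +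
        (if IsAdmissible single (c, false, false) then 1 else 0)) := by
    rw [Nat.card_eq_fintype_card, Fintype.card_subtype, Finset.card_filter]
    simp only [Fintype.sum_prod_type, Fintype.sum_bool]
    exact Finset.sum_congr rfl fun c _ => by ring
  rw [key]
  by_cases hs : single
  · obtain ⟨l, rfl⟩ : ∃ l, k = l + 2 := ⟨k - 2, by have := h hs; omega⟩
    rw [Fin.sum_univ_succ, Fin.sum_univ_succ, Finset.sum_eq_zero]
    · simp [IsAdmissible, hs]
    · intro c _
      simp [IsAdmissible, hs]
  · obtain ⟨l, rfl⟩ : ∃ l, k = l + 1 := ⟨k - 1, by omega⟩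
    rw [Fin.sum_univ_succ, Fin.sum_univ_castSucc]
    have hmid : ∀ c : Fin l, (c : ℕ) ≠ l := fun c => by omega
    simp [IsAdmissible, hs, hmid]
    ring

/-- The combinatorial code of a region: the coordinates are grouped into `k` levels by increasing
absolute value (the surjection), the threshold `1` is inserted before level `c`, and the signs
alternate from level to level on each side of the threshold, starting from two prescribed signs. -/
abbrev RegionCode (n : ℕ) : Type :=
  Σ k : Fin (n + 1), Σ f : {f : Fin n → Fin k // Surjective f},
    {t : Fin (k + 1) × Bool × Bool // IsAdmissible (∃! i, (f.1 i : ℕ) = 0) t}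

open Classical in
theorem card_regionCode_level {n k : ℕ} (hn : 2 ≤ n) (hk : 1 ≤ k) :
    (Nat.card (Σ f : {f : Fin n → Fin k // Surjective f},
      {t : Fin (k + 1) × Bool × Bool // IsAdmissible (∃! i, (f.1 i : ℕ) = 0) t}) : ℤ) =
    4 * (Nat.card {f : Fin n → Fin k // Surjective f} : ℤ) +
      4 * ((Nat.factorial k : ℤ) - (Nat.factorial (k - 1) : ℤ)) *
        ((k : ℤ) * (Nat.stirlingSecond n k : ℤ) -
          (n : ℤ) * (Nat.stirlingSecond (n - 1) (k - 1) : ℤ)) := by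
  -- with one level, all `n ≥ 2` elements are in level `0`
  have hsingle : ∀ f : {f : Fin n → Fin k // Surjective f},
      (∃! i, (f.1 i : ℕ) = 0) → 2 ≤ k := by
    rintro f ⟨a, -, ha⟩
    by_contra hlt
    have h1 := ha ⟨0, by omega⟩ (by omega)
    have h2 := ha ⟨1, by omega⟩ (by omega)
    simpa using h1.trans h2.symm
  rw [Nat.card_sigma, Finset.sum_congr rfl fun f _ => card_isAdmissible hk _ (hsingle f),
    Finset.sum_ite, Finset.sum_const, Finset.sum_const, smul_eq_mul, smul_eq_mul]
  have hsplit := Finset.card_filter_add_card_filter_not (s := Finset.univ)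
    (fun f : {f : Fin n → Fin k // Surjective f} => ∃! i, (f.1 i : ℕ) = 0)
  rw [Finset.card_univ, ← Nat.card_eq_fintype_card] at hsplit
  obtain ⟨m, rfl⟩ : ∃ m, n = m + 1 := ⟨n - 1, by omega⟩
  obtain ⟨l, rfl⟩ : ∃ l, k = l + 1 := ⟨k - 1, by omega⟩
  have hs := Nat.card_surjective_fin_existsUnique_zero m l
  rw [Nat.card_eq_fintype_card, Fintype.card_subtype, Nat.card_surjective_fin] at hs
  rw [hs] at hsplit ⊢
  have hcard := Nat.card_surjective_fin (m + 1) (l + 1)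
  rw [hcard] at hsplit ⊢
  generalize (Finset.univ.filter fun f : {f : Fin (m + 1) → Fin (l + 1) // Surjective f} =>
    ¬ ∃! i, (f.1 i : ℕ) = 0).card = N at hsplit ⊢
  zify at hsplit
  rw [← eq_sub_iff_add_eq'] at hsplit
  push_cast
  rw [hsplit, Nat.factorial_succ]
  push_cast
  ring

theorem card_regionCode {n : ℕ} (hn : 2 ≤ n) :
    (Nat.card (RegionCode n) : ℤ) =
      4 * (orderedBell n : ℤ) +
        ∑ k ∈ Finset.Icc 1 n,
          4 * ((Nat.factorial k : ℤ) - (Nat.factorial (k - 1) : ℤ)) *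
            ((k : ℤ) * (Nat.stirlingSecond n k : ℤ) -
              (n : ℤ) * (Nat.stirlingSecond (n - 1) (k - 1) : ℤ)) := by
  classical
  have h0 : IsEmpty {f : Fin n → Fin 0 // Surjective f} :=
    ⟨fun f => (f.1 ⟨0, by omega⟩).elim0⟩
  have hrange : ∀ g : ℕ → ℤ, g 0 = 0 →
      ∑ k ∈ Finset.range (n + 1), g k = ∑ k ∈ Finset.Icc 1 n, g k := fun g hg => by
    rw [Finset.sum_range_succ', hg, add_zero, Finset.range_eq_Ico, Finset.sum_Ico_add' g 0 n 1]
    rfl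
  rw [RegionCode, Nat.card_sigma, orderedBell]
  simp only [Nat.card_isOrderedSetPartition]
  push_cast
  rw [Fin.sum_univ_eq_sum_range (fun k : ℕ => (Nat.card
      (Σ f : {f : Fin n → Fin k // Surjective f},
        {t : Fin (k + 1) × Bool × Bool // IsAdmissible (∃! i, (f.1 i : ℕ) = 0) t}) : ℤ)) (n + 1),
    hrange _ (by simp), hrange _ (by simp), Finset.mul_sum, ← Finset.sum_add_distrib]
  exact Finset.sum_congr rfl fun k hk => card_regionCode_level hn (Finset.mem_Icc.1 hk).1

/-! ### Regions and sides of hyperplanes -/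

/-- `u` lies on none of the hyperplanes `u i + u j = 0` and `u i = ±1`, the image of the boxed
threshold arrangement under `x ↦ 2 x - 1`. -/
structure IsGeneric {n : ℕ} (u : Fin n → ℝ) : Prop where
  add_ne_zero : ∀ i j, i ≠ j → u i + u j ≠ 0
  ne_one : ∀ i, u i ≠ 1
  ne_neg_one : ∀ i, u i ≠ -1

/-- `u` and `v` lie on the same side of every hyperplane of the centred arrangement. -/
structure SameSide {n : ℕ} (u v : Fin n → ℝ) : Prop where
  add_pos_iff : ∀ i j, i ≠ j → (0 < u i + u j ↔ 0 < v i + v j)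
  one_lt_iff : ∀ i, 1 < u i ↔ 1 < v i
  lt_neg_one_iff : ∀ i, u i < -1 ↔ v i < -1

theorem SameSide.symm {n : ℕ} {u v : Fin n → ℝ} (h : SameSide u v) : SameSide v u :=
  ⟨fun i j hij => (h.1 i j hij).symm, fun i => (h.2 i).symm, fun i => (h.3 i).symm⟩

theorem IsGeneric.abs_ne_one {n : ℕ} {u : Fin n → ℝ} (hu : IsGeneric u) (i : Fin n) :
    |u i| ≠ 1 := fun h => by
  rcases (abs_eq zero_le_one).1 h with h | h
  · exact hu.ne_one i h
  · exact hu.ne_neg_one i h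

theorem mem_compl_sUnion_boxedThresholdArrangement {n : ℕ} {x : Fin n → ℝ} :
    x ∈ (⋃₀ boxedThresholdArrangement n)ᶜ ↔ IsGeneric fun i => 2 * x i - 1 := by
  constructor
  · intro hx
    refine ⟨fun i j hij h => hx ?_, fun i h => hx ⟨_, Or.inr ⟨i, Or.inr rfl⟩, ?_⟩,
      fun i h => hx ⟨_, Or.inr ⟨i, Or.inl rfl⟩, ?_⟩⟩
    · rcases lt_or_gt_of_ne hij with hlt | hlt
      · exact ⟨_, Or.inl ⟨i, j, hlt, rfl⟩, by simp only [Set.mem_ofPred_eq]; linarith⟩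
      · exact ⟨_, Or.inl ⟨j, i, hlt, rfl⟩, by simp only [Set.mem_ofPred_eq]; linarith⟩
    · simp only [Set.mem_ofPred_eq]; linarith
    · simp only [Set.mem_ofPred_eq]; linarith
  · rintro hx ⟨H, ⟨i, j, hij, rfl⟩ | ⟨i, rfl | rfl⟩, hxH⟩
    · exact hx.add_ne_zero i j hij.ne (by simp only [Set.mem_ofPred_eq] at hxH; linarith)
    · exact hx.ne_neg_one i (by simp only [Set.mem_ofPred_eq] at hxH; linarith)
    · exact hx.ne_one i (by simp only [Set.mem_ofPred_eq] at hxH; linarith)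

theorem IsPreconnected.pos_iff_of_ne_zero {X : Type*} [TopologicalSpace X] {C : Set X}
    (hC : IsPreconnected C) {g : X → ℝ} (hg : Continuous g) (h0 : ∀ z ∈ C, g z ≠ 0) {x y : X}
    (hx : x ∈ C) (hy : y ∈ C) : 0 < g x ↔ 0 < g y := by
  have key : ∀ {x y}, x ∈ C → y ∈ C → 0 < g x → 0 < g y := by
    intro x y hx hy hpos
    by_contra hneg
    obtain ⟨z, hz, hz0⟩ :=
      hC.intermediate_value hy hx hg.continuousOn ⟨not_lt.1 hneg, hpos.le⟩
    exact h0 z hz hz0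
  exact ⟨key hx hy, key hy hx⟩

theorem connectedComponentIn_eq_iff_sameSide {n : ℕ} {x y : Fin n → ℝ}
    (hx : x ∈ (⋃₀ boxedThresholdArrangement n)ᶜ) (hy : y ∈ (⋃₀ boxedThresholdArrangement n)ᶜ) :
    connectedComponentIn (⋃₀ boxedThresholdArrangement n)ᶜ x =
        connectedComponentIn (⋃₀ boxedThresholdArrangement n)ᶜ y ↔
      SameSide (fun i => 2 * x i - 1) (fun i => 2 * y i - 1) := by
  constructor
  · intro h
    have hyC : y ∈ connectedComponentIn (⋃₀ boxedThresholdArrangement n)ᶜ x :=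
      h ▸ mem_connectedComponentIn hy
    have hxC := mem_connectedComponentIn hx
    have hC := isPreconnected_connectedComponentIn (x := x)
      (F := (⋃₀ boxedThresholdArrangement n)ᶜ)
    have hgen : ∀ z ∈ connectedComponentIn (⋃₀ boxedThresholdArrangement n)ᶜ x,
        IsGeneric fun i => 2 * z i - 1 := fun z hz =>
      mem_compl_sUnion_boxedThresholdArrangement.1 (connectedComponentIn_subset _ _ hz)
    refine ⟨fun i j hij => ?_, fun i => ?_, fun i => ?_⟩
    · exact hC.pos_iff_of_ne_zero (g := fun z => (2 * z i - 1) + (2 * z j - 1)) (by fun_prop)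
        (fun z hz => (hgen z hz).add_ne_zero i j hij) hxC hyC
    · have := hC.pos_iff_of_ne_zero (g := fun z => (2 * z i - 1) - 1) (by fun_prop)
        (fun z hz => sub_ne_zero.2 ((hgen z hz).ne_one i)) hxC hyC
      simpa only [sub_pos] using this
    · have := hC.pos_iff_of_ne_zero (g := fun z => -1 - (2 * z i - 1)) (by fun_prop)
        (fun z hz => sub_ne_zero.2 ((hgen z hz).ne_neg_one i).symm) hxC hyC
      simpa only [sub_pos] using this
  · intro h
    have hgx := mem_compl_sUnion_boxedThresholdArrangement.1 hx
    have hgy := mem_compl_sUnion_boxedThresholdArrangement.1 hy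
    -- two nonzero numbers of the same sign have no vanishing convex combination
    have comb : ∀ {p q a b : ℝ}, 0 ≤ a → 0 ≤ b → a + b = 1 → p ≠ 0 → q ≠ 0 → (0 < p ↔ 0 < q) →
        a * p + b * q ≠ 0 := by
      intro p q a b ha hb hab hp hq hpq
      rcases lt_or_gt_of_ne hp with hp' | hp'
      · have hq' : q < 0 := lt_of_le_of_ne (not_lt.1 fun h => hp'.not_gt (hpq.2 h)) hq
        exact (convex_Iio (0 : ℝ) hp' hq' ha hb hab).ne
      · exact (convex_Ioi (0 : ℝ) hp' (hpq.1 hp') ha hb hab).ne'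
    have hseg : segment ℝ x y ⊆ (⋃₀ boxedThresholdArrangement n)ᶜ := by
      rintro _ ⟨a, b, ha, hb, hab, rfl⟩
      rw [mem_compl_sUnion_boxedThresholdArrangement]
      simp only [Pi.add_apply, Pi.smul_apply, smul_eq_mul]
      refine ⟨fun i j hij h0 => ?_, fun i h0 => ?_, fun i h0 => ?_⟩
      · refine comb ha hb hab (hgx.add_ne_zero i j hij) (hgy.add_ne_zero i j hij)
          (h.add_pos_iff i j hij) ?_
        linear_combination h0 - 2 * hab
      · refine comb ha hb hab (sub_ne_zero.2 (hgx.ne_one i)) (sub_ne_zero.2 (hgy.ne_one i))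
          (by simpa only [sub_pos] using h.one_lt_iff i) ?_
        linear_combination h0 - 2 * hab
      · refine comb ha hb hab (sub_ne_zero.2 (hgx.ne_neg_one i).symm)
          (sub_ne_zero.2 (hgy.ne_neg_one i).symm)
          (by simpa only [sub_pos] using h.lt_neg_one_iff i) ?_
        linear_combination -h0
    have := (convex_segment x y).isPreconnected.subset_connectedComponentIn
      (left_mem_segment ℝ x y) hseg (right_mem_segment ℝ x y)
    exact connectedComponentIn_eq this

/-! ### Uniqueness of the code of a point -/

/-- The sign (`true` for positive) of a coordinate: alternating along the levels, starting from
`e.1` below the threshold and from `e.2` above it. -/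
def levelSign {n : ℕ} (f : Fin n → ℕ) (c : ℕ) (e : Bool × Bool) (i : Fin n) : Bool :=
  xor (if f i < c then e.1 else e.2) (f i).bodd

/-- The position of `u` relative to the centred arrangement is the one prescribed by the levels
`f`, the threshold `c` and the signs `σ`: in a sum of two coordinates the higher level prevails. -/
structure Represents {n : ℕ} (f : Fin n → ℕ) (c : ℕ) (σ : Fin n → Bool) (u : Fin n → ℝ) :
    Prop where
  add_pos_iff : ∀ i j, i ≠ j → f j ≤ f i → (0 < u i + u j ↔ σ i = true)
  one_lt_iff : ∀ i, 1 < u i ↔ c ≤ f i ∧ σ i = true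
  lt_neg_one_iff : ∀ i, u i < -1 ↔ c ≤ f i ∧ σ i = false

section Represents

variable {n : ℕ} {f f' : Fin n → ℕ} {c c' : ℕ} {σ σ' : Fin n → Bool} {u v : Fin n → ℝ}

theorem Represents.sameSide (hu : Represents f c σ u) (hv : Represents f c σ v) :
    SameSide u v := by
  refine ⟨fun i j hij => ?_, fun i => by rw [hu.one_lt_iff, hv.one_lt_iff],
    fun i => by rw [hu.lt_neg_one_iff, hv.lt_neg_one_iff]⟩
  rcases le_total (f j) (f i) with h | h
  · rw [hu.add_pos_iff i j hij h, hv.add_pos_iff i j hij h]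
  · rw [add_comm, add_comm (v i), hu.add_pos_iff j i hij.symm h, hv.add_pos_iff j i hij.symm h]

theorem Represents.congr (hu : Represents f c σ u) (h : SameSide u v) : Represents f c σ v :=
  ⟨fun i j hij hle => (h.add_pos_iff i j hij).symm.trans (hu.add_pos_iff i j hij hle),
    fun i => (h.one_lt_iff i).symm.trans (hu.one_lt_iff i),
    fun i => (h.lt_neg_one_iff i).symm.trans (hu.lt_neg_one_iff i)⟩

theorem Represents.threshold_le_iff (hu : Represents f c σ u) (hu' : Represents f' c' σ' u)
    (i : Fin n) : c ≤ f i ↔ c' ≤ f' i := by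
  have h1 := (hu.one_lt_iff i).symm.trans (hu'.one_lt_iff i)
  have h2 := (hu.lt_neg_one_iff i).symm.trans (hu'.lt_neg_one_iff i)
  cases h : σ i <;> cases h' : σ' i <;> simp_all <;> omega

theorem Represents.sign_eq_of_threshold_le (hu : Represents f c σ u)
    (hu' : Represents f' c' σ' u) {i : Fin n} (hi : c ≤ f i) : σ i = σ' i := by
  have h1 := (hu.one_lt_iff i).symm.trans (hu'.one_lt_iff i)
  have h2 := (hu.lt_neg_one_iff i).symm.trans (hu'.lt_neg_one_iff i)
  cases h : σ i <;> cases h' : σ' i <;> simp_all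

/-- A coordinate that is not strictly below all others in either of two codes of `u` has the same
sign in both. Otherwise, let `j` and `j'` be coordinates below `i` in the two codes: then `j'` has the
sign `σ' i` and lies above `j` in the first code, while `j` has the sign `σ i` and lies above `j'` in
the second, so that the codes disagree about `u j + u j'`. -/
theorem Represents.not_sign_ne (hu : Represents f c σ u) (hu' : Represents f' c' σ' u)
    {i j j' : Fin n} (hj : j ≠ i) (hji : f j ≤ f i) (hj' : j' ≠ i) (hji' : f' j' ≤ f' i)
    (h : σ i = true) (h' : σ' i = false) : False := by
  have h1 : 0 < u i + u j := (hu.add_pos_iff i j hj.symm hji).2 h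
  have h2 : ¬ 0 < u i + u j' := by
    rw [hu'.add_pos_iff i j' hj'.symm hji', h']
    simp
  have hlt : f i < f j' := by
    by_contra hle
    exact h2 ((hu.add_pos_iff i j' hj'.symm (not_lt.1 hle)).2 h)
  have hlt' : f' i < f' j := by
    by_contra hle
    have := (hu'.add_pos_iff i j hj.symm (not_lt.1 hle)).1 h1
    simp [h'] at this
  have hne : j ≠ j' := by
    rintro rfl
    omega
  rw [add_comm, hu.add_pos_iff j' i hj' hlt.le] at h2
  rw [add_comm, hu'.add_pos_iff j i hj hlt'.le] at h1
  rw [← hu'.add_pos_iff j j' hne (by omega), add_comm,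
    hu.add_pos_iff j' j hne.symm (by omega)] at h1
  exact h2 h1

/-- Under an admissible code, a coordinate below the threshold either is not strictly below all
others, or is positive and the only one below the threshold. -/
theorem IsAdmissible.exists_le_or {k : ℕ} {t : Fin (k + 1) × Bool × Bool}
    (hf : ∀ i b, b ≤ f i → ∃ j, f j = b) (ht : IsAdmissible (∃! i, f i = 0) t) {i : Fin n}
    (hi : f i < t.1) :
    (∃ j, j ≠ i ∧ f j ≤ f i) ∨ (levelSign f t.1 t.2 i = true ∧ ∀ j, j ≠ i → t.1 ≤ f j) := by
  by_contra! hcon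
  obtain ⟨hlow, hcon⟩ := hcon
  have hi0 : f i = 0 := by
    obtain ⟨j, hj⟩ := hf i 0 (Nat.zero_le _)
    by_cases hji : j = i
    · exact hji ▸ hj
    · have := hlow j hji
      omega
  obtain ⟨h1, h2⟩ := ht.2.2 ⟨i, hi0, fun j hj => by
    by_contra hji
    have := hlow j hji
    simp only at hj
    omega⟩
  have ht1 : (t.1 : ℕ) = 1 := by omega
  obtain ⟨j, hji, hj⟩ := hcon (by simp [levelSign, hi0, ht1, h2 ht1])
  have := hlow j hji
  omega

theorem Represents.sign_eq {k k' : ℕ} {t : Fin (k + 1) × Bool × Bool}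
    {t' : Fin (k' + 1) × Bool × Bool} (hf : ∀ i b, b ≤ f i → ∃ j, f j = b)
    (hf' : ∀ i b, b ≤ f' i → ∃ j, f' j = b) (ht : IsAdmissible (∃! i, f i = 0) t)
    (ht' : IsAdmissible (∃! i, f' i = 0) t') (hu : Represents f t.1 (levelSign f t.1 t.2) u)
    (hu' : Represents f' t'.1 (levelSign f' t'.1 t'.2) u) :
    levelSign f t.1 t.2 = levelSign f' t'.1 t'.2 := by
  funext i
  by_cases hi : t.1 ≤ f i
  · exact hu.sign_eq_of_threshold_le hu' hi
  have hi' : ¬ t'.1 ≤ f' i := (hu.threshold_le_iff hu' i).not.1 hi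
  rcases ht.exists_le_or hf (not_le.1 hi) with ⟨j, hj, hji⟩ | ⟨hs, hj⟩ <;>
  rcases ht'.exists_le_or hf' (not_le.1 hi') with ⟨j', hj', hji'⟩ | ⟨hs', hj'⟩
  · cases h : levelSign f t.1 t.2 i <;> cases h' : levelSign f' t'.1 t'.2 i
    · rfl
    · exact (hu'.not_sign_ne hu hj' hji' hj hji h' h).elim
    · exact (hu.not_sign_ne hu' hj hji hj' hji' h h').elim
    · rfl
  · have := (hu.threshold_le_iff hu' j).2 (hj' j hj)
    omega
  · have := (hu.threshold_le_iff hu' j').1 (hj j' hj')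
    omega
  · rw [hs, hs']

theorem levelSign_succ_ne {e : Bool × Bool} {i j : Fin n} (h : f i = f j + 1)
    (hc : c ≤ f i → c ≤ f j) : levelSign f c e i ≠ levelSign f c e j := by
  by_cases hi : f i < c
  · have hj : f j < c := by omega
    rw [levelSign, levelSign, if_pos hi, if_pos hj, h, Nat.bodd_succ]
    simp
  · have hj : ¬ f j < c := by omega
    rw [levelSign, levelSign, if_neg hi, if_neg hj, h, Nat.bodd_succ]
    simp

/-- Each level above the bottom one is forced to lie above the previous level, by alternation of
signs or by the threshold, and this holds for every code of `u` with the same signs. -/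
theorem Represents.level_le {e e' : Bool × Bool} (hf : ∀ i b, b ≤ f i → ∃ j, f j = b)
    (hu : Represents f c (levelSign f c e) u) (hu' : Represents f' c' (levelSign f' c' e') u)
    (hσ : levelSign f c e = levelSign f' c' e') (i : Fin n) : f i ≤ f' i := by
  induction hb : f i generalizing i with
  | zero => exact Nat.zero_le _
  | succ b ih =>
    obtain ⟨j, hj⟩ := hf i b (by omega)
    have hle := ih j hj
    suffices f' j < f' i by omega
    by_contra hcon
    have hci := hu.threshold_le_iff hu' i
    have hcj := hu.threshold_le_iff hu' j
    by_cases hc : c ≤ f i → c ≤ f j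
    · have hij : i ≠ j := by
        rintro rfl
        omega
      have h1 := hu.add_pos_iff i j hij (by omega)
      have h2 := hu'.add_pos_iff j i hij.symm (by omega)
      have hne := levelSign_succ_ne (e := e) (hb.trans (by rw [hj])) hc
      rw [add_comm, h1, ← hσ, Bool.coe_iff_coe] at h2
      exact hne h2
    · omega

end Represents

/-! ### A point for every code -/

/-- The point with absolute values `(2 * f i + 2) / (2 * c + 1)`, which increase with the level and
pass `1` between the levels `c - 1` and `c`. -/
noncomputable def levelPoint {n : ℕ} (f : Fin n → ℕ) (c : ℕ) (σ : Fin n → Bool) (i : Fin n) : ℝ :=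
  (if σ i then 1 else -1) * ((2 * f i + 2) / (2 * c + 1))

theorem represents_levelPoint {n : ℕ} {f : Fin n → ℕ} {c : ℕ} {σ : Fin n → Bool}
    (hσ : ∀ i j, f i = f j → σ i = σ j) : Represents f c σ (levelPoint f c σ) := by
  have hpos : ∀ i, (0 : ℝ) < (2 * f i + 2) / (2 * c + 1) := fun i => by positivity
  have hone : ∀ i, (1 : ℝ) < (2 * f i + 2) / (2 * c + 1) ↔ c ≤ f i := fun i => by
    rw [one_lt_div (by positivity)]
    norm_cast
    omega
  refine ⟨fun i j _ hle => ?_, fun i => ?_, fun i => ?_⟩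
  · have hi := hpos i
    have hj := hpos j
    rcases hle.eq_or_lt with heq | hlt
    · have := hσ j i heq
      cases h : σ i <;> simp [levelPoint, this, h] <;> linarith
    · have : ((2 * f j + 2) / (2 * c + 1) : ℝ) < (2 * f i + 2) / (2 * c + 1) := by
        gcongr
      cases h : σ i <;> cases h' : σ j <;> simp [levelPoint, h, h'] <;> linarith
  · have hi := hpos i
    rw [← hone]
    cases h : σ i <;> simp [levelPoint, h]
    linarith
  · have hi := hpos i
    rw [← hone]
    cases h : σ i <;> simp [levelPoint, h]
    linarith

theorem isGeneric_levelPoint {n : ℕ} {f : Fin n → ℕ} {c : ℕ} {σ : Fin n → Bool}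
    (hσ : ∀ i j, f i = f j → σ i = σ j) : IsGeneric (levelPoint f c σ) := by
  have hne : ∀ i, ((2 * f i + 2) / (2 * c + 1) : ℝ) ≠ 1 := fun i => by
    rw [Ne, div_eq_one_iff_eq (by positivity)]
    norm_cast
    omega
  have hpos : ∀ i, (0 : ℝ) < (2 * f i + 2) / (2 * c + 1) := fun i => by positivity
  refine ⟨fun i j _ h0 => ?_, fun i h => ?_, fun i h => ?_⟩
  · have hi := hpos i
    have hj := hpos j
    have hσij : σ i ≠ σ j := fun h => by
      cases h' : σ j <;> simp only [levelPoint, h, h'] at h0 <;> norm_num at h0 <;> linarith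
    refine hσij (hσ i j ?_)
    have : ((2 * f i + 2) / (2 * c + 1) : ℝ) = (2 * f j + 2) / (2 * c + 1) := by
      cases h : σ i <;> cases h' : σ j <;> simp only [levelPoint, h, h', ne_eq, not_true] at * <;>
        norm_num at h0 <;> linarith
    rw [div_left_inj' (by positivity)] at this
    norm_cast at this
    omega
  · have := hpos i
    cases h' : σ i <;> simp only [levelPoint, h'] at h <;> norm_num at h
    · linarith
    · exact hne i h
  · have := hpos i
    cases h' : σ i <;> simp only [levelPoint, h'] at h <;> norm_num at h
    · exact hne i h
    · linarith

/-! ### Normalising a point and its levels -/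

section Existence

variable {n : ℕ} {u : Fin n → ℝ}

theorem add_pos_iff_of_abs_le {a b : ℝ} (h : |a| ≤ |b|) (h0 : a + b ≠ 0) :
    0 < a + b ↔ 0 < b := by
  constructor
  · intro hab
    by_contra hb
    rw [abs_of_nonpos (not_lt.1 hb)] at h
    linarith [le_abs_self a]
  · intro hb
    rw [abs_of_pos hb] at h
    exact lt_of_le_of_ne (by linarith [neg_abs_le a]) h0.symm

/-- The coordinate of smallest absolute value can be changed freely as long as its absolute value
stays below the threshold and at most all others, and the new point is on no hyperplane. -/
theorem IsGeneric.update_sameSide (hu : IsGeneric u) {a : Fin n} {x : ℝ} (ha : |u a| < 1)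
    (hx : |x| < 1) (hua : ∀ j, j ≠ a → |u a| ≤ |u j|) (hxj : ∀ j, j ≠ a → |x| ≤ |u j|)
    (hne : ∀ j, j ≠ a → x + u j ≠ 0) : IsGeneric (update u a x) ∧ SameSide u (update u a x) := by
  rw [abs_lt] at ha hx
  have hpos : ∀ j, j ≠ a → (0 < u a + u j ↔ 0 < x + u j) := fun j hj => by
    rw [add_pos_iff_of_abs_le (hua j hj) (hu.add_ne_zero a j hj.symm),
      add_pos_iff_of_abs_le (hxj j hj) (hne j hj)]
  refine ⟨⟨fun i j hij => ?_, fun i => ?_, fun i => ?_⟩, ⟨fun i j hij => ?_, fun i => ?_,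
    fun i => ?_⟩⟩
  · by_cases hi : i = a
    · subst hi
      simpa [hij.symm] using hne j hij.symm
    · by_cases hj : j = a
      · subst hj
        simpa [hi, add_comm] using hne i hi
      · simpa [hi, hj] using hu.add_ne_zero i j hij
  · by_cases hi : i = a
    · subst hi
      simpa using hx.2.ne
    · simpa [hi] using hu.ne_one i
  · by_cases hi : i = a
    · subst hi
      simpa using hx.1.ne'
    · simpa [hi] using hu.ne_neg_one i
  · by_cases hi : i = a
    · subst hi
      simpa [hij.symm] using hpos j hij.symm
    · by_cases hj : j = a
      · subst hj
        simpa [hi, add_comm] using hpos i hi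
      · simp [hi, hj]
  · by_cases hi : i = a
    · subst hi
      simp only [update_self]
      constructor <;> intro <;> linarith
    · simp [hi]
  · by_cases hi : i = a
    · subst hi
      simp only [update_self]
      constructor <;> intro <;> linarith
    · simp [hi]

/-- Within its region, a point can be moved so that no coordinate vanishes and the smallest absolute
value, if it is below the threshold, is attained by two equal coordinates, unless it belongs to the
only coordinate below the threshold, which is then made positive. -/
theorem IsGeneric.exists_normalized (hu : IsGeneric u) :
    ∃ v, IsGeneric v ∧ SameSide u v ∧ (∀ i, v i ≠ 0) ∧ ∀ i, |v i| < 1 →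
      (∃ a b, a ≠ b ∧ v a = v b ∧ ∀ j, |v a| ≤ |v j|) ∨ (0 < v i ∧ ∀ j, j ≠ i → 1 < |v j|) := by
  by_cases hM : ∀ i, ¬ |u i| < 1
  · refine ⟨u, hu, ⟨fun _ _ _ => Iff.rfl, fun _ => Iff.rfl, fun _ => Iff.rfl⟩, fun i h => ?_,
      fun i h => absurd h (hM i)⟩
    exact hM i (by simp [h])
  push Not at hM
  obtain ⟨i₀, hi₀⟩ := hM
  have : Nonempty (Fin n) := ⟨i₀⟩
  obtain ⟨a, ha⟩ := Finite.exists_min fun i => |u i|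
  have ha1 : |u a| < 1 := (ha i₀).trans_lt hi₀
  by_cases hb : ∃ b, b ≠ a ∧ |u b| < 1
  · obtain ⟨b₀, hb₀, hb₀1⟩ := hb
    obtain ⟨b, hbmem, hb⟩ := Finset.exists_min_image (Finset.univ.erase a) (fun i => |u i|)
      ⟨b₀, by simpa using hb₀⟩
    have hba : b ≠ a := Finset.ne_of_mem_erase hbmem
    have hb' : ∀ j, j ≠ a → |u b| ≤ |u j| := fun j hj => hb j (by simpa using hj)
    have hb1 : |u b| < 1 := (hb' b₀ hb₀).trans_lt hb₀1
    have hb0 : u b ≠ 0 := fun h0 => by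
      have h1 := ha b
      simp only [h0, abs_zero, abs_nonpos_iff] at h1
      exact hu.add_ne_zero b a hba (by rw [h0, h1, add_zero])
    obtain ⟨hv, hside⟩ := hu.update_sameSide ha1 hb1 (fun j _ => ha j) hb' fun j hj => by
      by_cases hjb : j = b
      · subst hjb
        intro h
        exact hb0 (by linarith)
      · exact hu.add_ne_zero b j (Ne.symm hjb)
    refine ⟨_, hv, hside, fun i => ?_, fun _ _ => Or.inl ⟨a, b, hba.symm, by simp [hba],
      fun j => ?_⟩⟩
    · by_cases hi : i = a
      · subst hi
        simpa using hb0
      · simp only [ne_eq, hi, not_false_eq_true, update_of_ne]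
        intro h0
        have h1 := hb' i hi
        simp only [h0, abs_zero, abs_nonpos_iff] at h1
        exact hb0 h1
    · by_cases hj : j = a
      · subst hj
        exact le_rfl
      · simpa [hj] using hb' j hj
  · push Not at hb
    have hlt : ∀ j, j ≠ a → 1 < |u j| := fun j hj =>
      lt_of_le_of_ne (hb j hj) (hu.abs_ne_one j).symm
    -- any positive value below the threshold would do
    have hhalf : |(1 / 2 : ℝ)| = 1 / 2 := abs_of_pos (by norm_num)
    obtain ⟨hv, hside⟩ := hu.update_sameSide (x := 1 / 2) ha1 (by rw [hhalf]; norm_num)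
      (fun j _ => ha j) (fun j hj => by rw [hhalf]; linarith [hlt j hj]) fun j hj h0 => by
        have h1 := hlt j hj
        rw [show u j = -(1 / 2) by linarith, abs_neg, hhalf] at h1
        norm_num at h1
    refine ⟨_, hv, hside, fun i => ?_, fun i hi => Or.inr ?_⟩
    · by_cases hi : i = a
      · subst hi
        simp
      · simp only [ne_eq, hi, not_false_eq_true, update_of_ne]
        intro h0
        have h1 := hlt i hi
        rw [h0, abs_zero] at h1
        linarith
    · have hia : i = a := by
        by_contra hne
        rw [update_of_ne hne] at hi
        exact lt_asymm hi (hlt i hne)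
      subst hia
      refine ⟨by simp, fun j hj => ?_⟩
      rw [update_of_ne hj]
      exact hlt j hj

/-- The level of an element is the length of the longest `r`-chain ending at it. -/
theorem WellFounded.exists_level {ι : Type*} [Finite ι] {r : ι → ι → Prop} (hr : WellFounded r) :
    ∃ f : ι → ℕ, (∀ i j, r i j → f i < f j) ∧ ∀ j t, f j = t + 1 → ∃ i, r i j ∧ f i = t := by
  classical
  cases nonempty_fintype ι
  let f : ι → ℕ := hr.fix fun j F => Finset.univ.sup fun i => if h : r i j then F i h + 1 else 0
  have hf : ∀ j, f j = Finset.univ.sup fun i => if r i j then f i + 1 else 0 := fun j => by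
    simp only [f]
    rw [hr.fix_eq]
    simp only [dite_eq_ite]
  refine ⟨f, fun i j hij => ?_, fun j t hj => ?_⟩
  · have := Finset.le_sup (f := fun i => if r i j then f i + 1 else 0) (Finset.mem_univ i)
    rw [← hf, if_pos hij] at this
    omega
  · obtain ⟨i, -, hi⟩ := Finset.exists_mem_eq_sup Finset.univ ⟨j, Finset.mem_univ j⟩
      fun i => if r i j then f i + 1 else 0
    rw [← hf, hj] at hi
    by_cases hij : r i j
    · rw [if_pos hij] at hi
      exact ⟨i, hij, by omega⟩
    · rw [if_neg hij] at hi
      omega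

end Existence

/-! ### Codes and regions -/

namespace RegionCode

variable {n : ℕ}

/-- The level of a coordinate. -/
def level (x : RegionCode n) (i : Fin n) : ℕ := x.2.1.1 i

/-- The number of levels below the threshold. -/
def threshold (x : RegionCode n) : ℕ := x.2.2.1.1

/-- The sign of a coordinate. -/
def sign (x : RegionCode n) : Fin n → Bool := levelSign x.level x.threshold x.2.2.1.2

theorem sign_eq_of_level_eq (x : RegionCode n) (i j : Fin n) (h : x.level i = x.level j) :
    x.sign i = x.sign j := by
  rw [sign, levelSign, levelSign, h]

theorem exists_level_eq (x : RegionCode n) {b : ℕ} (hb : b < x.1) : ∃ i, x.level i = b := by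
  obtain ⟨i, hi⟩ := x.2.1.2 ⟨b, hb⟩
  exact ⟨i, congrArg Fin.val hi⟩

theorem exists_level_eq_of_le (x : RegionCode n) (i : Fin n) (b : ℕ) (hb : b ≤ x.level i) :
    ∃ j, x.level j = b :=
  x.exists_level_eq (hb.trans_lt (x.2.1.1 i).2)

theorem eq_of_represents {u : Fin n → ℝ} {x y : RegionCode n}
    (hx : Represents x.level x.threshold x.sign u)
    (hy : Represents y.level y.threshold y.sign u) : x = y := by
  have hσ : x.sign = y.sign := Represents.sign_eq x.exists_level_eq_of_le y.exists_level_eq_of_le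
    x.2.2.2 y.2.2.2 hx hy
  have hl : x.level = y.level := funext fun i => le_antisymm
    (hx.level_le x.exists_level_eq_of_le hy hσ i)
    (hy.level_le y.exists_level_eq_of_le hx hσ.symm i)
  have hthr := hx.threshold_le_iff hy
  have hxe := fun (b : ℕ) (hb : b < x.1) => x.exists_level_eq hb
  have hye := fun (b : ℕ) (hb : b < y.1) => y.exists_level_eq hb
  have hk : x.1 = y.1 := by
    rcases lt_trichotomy (x.1 : ℕ) y.1 with h | h | h
    · obtain ⟨i, hi⟩ := hye _ h
      have : x.level i < x.1 := (x.2.1.1 i).2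
      rw [hl, hi] at this
      exact absurd this (lt_irrefl _)
    · exact Fin.ext h
    · obtain ⟨i, hi⟩ := hxe _ h
      have : y.level i < y.1 := (y.2.1.1 i).2
      rw [← hl, hi] at this
      exact absurd this (lt_irrefl _)
  obtain ⟨k, f, ⟨c, e⟩, ht⟩ := x
  obtain ⟨k', f', ⟨c', e'⟩, ht'⟩ := y
  obtain rfl : k = k' := hk
  obtain rfl : f = f' := Subtype.ext (funext fun i => Fin.ext (congrFun hl i))
  have hthr : ∀ i, (c : ℕ) ≤ f.1 i ↔ (c' : ℕ) ≤ f.1 i := hthr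
  have hxe : ∀ b : ℕ, b < k → ∃ i, (f.1 i : ℕ) = b := hxe
  have hσ : levelSign (fun i => (f.1 i : ℕ)) c e = levelSign (fun i => (f.1 i : ℕ)) c' e' := hσ
  have hc : c = c' := by
    rcases lt_trichotomy (c : ℕ) c' with h | h | h
    · obtain ⟨i, hi⟩ := hxe c (by omega)
      have := (hthr i).1 hi.ge
      omega
    · exact Fin.ext h
    · obtain ⟨i, hi⟩ := hxe c' (by omega)
      have := (hthr i).2 hi.ge
      omega
  subst hc
  have he1 : e.1 = e'.1 := by
    by_cases h0 : (c : ℕ) = 0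
    · rw [ht.1 h0, ht'.1 h0]
    · obtain ⟨i, hi⟩ := hxe 0 (by omega)
      have := congrFun hσ i
      simpa [levelSign, hi, Nat.pos_of_ne_zero h0] using this
  have he2 : e.2 = e'.2 := by
    by_cases h0 : (c : ℕ) = k
    · rw [ht.2.1 h0, ht'.2.1 h0]
    · obtain ⟨i, hi⟩ := hxe c (by omega)
      have := congrFun hσ i
      simpa [levelSign, hi] using this
  obtain rfl : e = e' := Prod.ext he1 he2
  rfl

/-- The levels of a normalised point are the lengths of the longest chains along which absolute
values increase and at each step the sign changes or the threshold is crossed. -/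
theorem exists_represents {u : Fin n → ℝ} (hu : IsGeneric u) :
    ∃ x : RegionCode n, Represents x.level x.threshold x.sign u := by
  obtain ⟨v, hv, hside, hv0, hnorm⟩ := hu.exists_normalized
  suffices ∃ x : RegionCode n, Represents x.level x.threshold x.sign v from
    this.imp fun x hx => hx.congr hside.symm
  let s : Fin n → Bool := fun i => decide (0 < v i)
  have hsneg : ∀ i, s i = false ↔ v i < 0 := fun i => by
    simp only [s, decide_eq_false_iff_not, not_lt]
    exact ⟨fun h => lt_of_le_of_ne h (hv0 i), le_of_lt⟩
  have hspos : ∀ i, s i = true ↔ 0 < v i := fun i => by simp [s]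
  let r : Fin n → Fin n → Prop := fun i j => |v i| < |v j| ∧ (s i ≠ s j ∨ |v i| < 1 ∧ 1 < |v j|)
  have hr : WellFounded r := by
    have : IsTrans (Fin n) fun i j => |v i| < |v j| := ⟨fun _ _ _ => lt_trans⟩
    have : Std.Irrefl fun i j : Fin n => |v i| < |v j| := ⟨fun _ => lt_irrefl _⟩
    exact Subrelation.wf (fun h => h.1)
      (Finite.wellFounded_of_trans_of_irrefl fun i j : Fin n => |v i| < |v j|)
  obtain ⟨f, hmono, hstep⟩ := hr.exists_level
  have hone : ∀ i, ¬ |v i| < 1 → 1 < |v i| := fun i h =>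
    lt_of_le_of_ne (not_lt.1 h) (hv.abs_ne_one i).symm
  have hcross : ∀ i j, |v i| < 1 → ¬ |v j| < 1 → f i < f j := fun i j hi hj =>
    hmono i j ⟨hi.trans (hone j hj), Or.inr ⟨hi, hone j hj⟩⟩
  have hmin : ∀ a, (∀ j, |v a| ≤ |v j|) → f a = 0 := fun a ha => by
    by_contra h
    obtain ⟨t, ht⟩ := Nat.exists_eq_succ_of_ne_zero h
    obtain ⟨i, hi, -⟩ := hstep a t ht
    exact absurd hi.1 (not_lt.2 (ha i))
  have hlevel : ∀ i j, f i = f j → s i = s j := fun i j hij => by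
    by_contra hne
    rcases lt_trichotomy |v i| |v j| with h | h | h
    · exact (hmono i j ⟨h, Or.inl hne⟩).ne hij
    · have hij' : i ≠ j := by
        rintro rfl
        exact hne rfl
      rcases abs_eq_abs.1 h with h | h
      · exact hne (by simp only [s, h])
      · exact hv.add_ne_zero i j hij' (by rw [h, neg_add_cancel])
    · exact (hmono j i ⟨h, Or.inl (Ne.symm hne)⟩).ne' hij
  have hdown : ∀ b j, b ≤ f j → ∃ i, f i = b := by
    intro b j hbj
    induction hd : f j - b generalizing j with
    | zero => exact ⟨j, by omega⟩
    | succ d ih =>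
      obtain ⟨i, -, hi⟩ := hstep j (f j - 1) (by omega)
      exact ih i (by omega) (by omega)
  -- on each side of the threshold the signs alternate with the level
  have hpar : ∀ i j, (|v i| < 1 ↔ |v j| < 1) → f i ≤ f j →
      xor (s i) (f i).bodd = xor (s j) (f j).bodd := by
    intro i j hij hle
    induction hd : f j - f i generalizing j with
    | zero =>
      have : f i = f j := by omega
      rw [this, hlevel i j this]
    | succ d ih =>
      obtain ⟨l, hl, hlt⟩ := hstep j (f j - 1) (by omega)
      have hlj : |v l| < 1 ↔ |v j| < 1 := by
        refine ⟨fun h => ?_, fun h => hl.1.trans h⟩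
        by_contra hj
        have := hcross l i h (hij.not.2 hj)
        omega
      rw [ih l (hij.trans hlj.symm) (by omega) (by omega), show f j = f l + 1 by omega,
        Nat.bodd_succ]
      have hne : s l ≠ s j := by
        rcases hl.2 with h | ⟨h1, h2⟩
        · exact h
        · exact absurd (hlj.1 h1) h2.not_gt
      revert hne
      cases s l <;> cases s j <;> simp
  -- the starting signs: `p` is `True` below the threshold and `False` above it
  have hbase : ∀ p : Prop, ∃ e : Bool, (∀ i, (|v i| < 1 ↔ p) → xor (s i) (f i).bodd = e) ∧
      ((∀ i, ¬ (|v i| < 1 ↔ p)) → e = true) := by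
    intro p
    by_cases h : ∃ i, |v i| < 1 ↔ p
    · obtain ⟨i, hi⟩ := h
      refine ⟨xor (s i) (f i).bodd, fun j hj => ?_, fun h => absurd hi (h i)⟩
      rcases le_total (f i) (f j) with hle | hle
      · exact (hpar i j (hi.trans hj.symm) hle).symm
      · exact hpar j i (hj.trans hi.symm) hle
    · exact ⟨true, fun i hi => absurd ⟨i, hi⟩ h, fun _ => rfl⟩
  obtain ⟨e₁, he₁, he₁'⟩ := hbase True
  obtain ⟨e₂, he₂, he₂'⟩ := hbase False
  simp only [iff_true, iff_false, not_not] at he₁ he₁' he₂ he₂'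
  let c : ℕ := (Finset.univ.filter fun i => |v i| < 1).sup fun i => f i + 1
  let k : ℕ := Finset.univ.sup fun i => f i + 1
  have hfk : ∀ i, f i < k := fun i =>
    Finset.le_sup (f := fun i => f i + 1) (Finset.mem_univ i)
  have hck : c ≤ k := Finset.sup_mono (Finset.subset_univ _)
  have hc : ∀ i, |v i| < 1 ↔ f i < c := fun i => by
    refine ⟨fun h => Finset.le_sup (f := fun i => f i + 1) (by simpa using h), fun h => ?_⟩
    by_contra hi
    refine h.not_ge (Finset.sup_le fun j hj => ?_)
    exact hcross j i (by simpa using hj) hi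
  have hsurj : Surjective fun i => (⟨f i, hfk i⟩ : Fin k) := fun b => by
    obtain ⟨j, -, hj⟩ := Finset.lt_sup_iff.1 b.2
    obtain ⟨i, hi⟩ := hdown b j (by omega)
    exact ⟨i, Fin.ext hi⟩
  have hkn : k ≤ n := by simpa using Fintype.card_le_of_surjective _ hsurj
  have hadm : IsAdmissible (k := k) (∃! i, f i = 0) (⟨c, Nat.lt_succ_of_le hck⟩, e₁, e₂) := by
    refine ⟨fun h0 => he₁' fun i hi => ?_, fun h0 => he₂' fun i => ?_, fun hsingle => ?_⟩
    · have := (hc i).1 hi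
      simp only at h0
      omega
    · rw [hc]
      simp only at h0
      rw [h0]
      exact hfk i
    · by_cases hM : ∀ i, ¬ |v i| < 1
      · have hc0 : c = 0 := Nat.le_zero.1 <| Finset.sup_le fun i hi =>
          absurd (Finset.mem_filter.1 hi).2 (hM i)
        simp [hc0]
      push Not at hM
      obtain ⟨i, hi⟩ := hM
      rcases hnorm i hi with ⟨a, b, hab, heq, ha⟩ | ⟨hpos, hlt⟩
      · exact absurd (hsingle.unique (hmin a ha) (hmin b fun j => heq ▸ ha j)) hab
      · have hi0 : f i = 0 := hmin i fun j => by
          by_cases hj : j = i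
          · rw [hj]
          · exact (hi.trans (hlt j hj)).le
        refine ⟨show c ≤ 1 from Finset.sup_le fun j hj => ?_, fun _ => ?_⟩
        · obtain rfl : j = i := by
            by_contra hne
            exact (hlt j hne).not_gt (Finset.mem_filter.1 hj).2
          omega
        · rw [← he₁ i hi, hi0, (hspos i).2 hpos]
          rfl
  have hsign : levelSign f c (e₁, e₂) = s := funext fun i => by
    by_cases hi : |v i| < 1
    · rw [levelSign, if_pos ((hc i).1 hi), ← he₁ i hi, Bool.xor_assoc, Bool.xor_self,
        Bool.xor_false]
    · rw [levelSign, if_neg ((hc i).not.1 hi), ← he₂ i hi, Bool.xor_assoc, Bool.xor_self,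
        Bool.xor_false]
  refine ⟨⟨⟨k, Nat.lt_succ_of_le hkn⟩, ⟨_, hsurj⟩, _, hadm⟩, ?_⟩
  change Represents f c (levelSign f c (e₁, e₂)) v
  rw [hsign]
  refine ⟨fun i j hij hle => ?_, fun i => ?_, fun i => ?_⟩
  · rw [hspos]
    by_cases habs : |v j| ≤ |v i|
    · rw [add_comm, add_pos_iff_of_abs_le habs (hv.add_ne_zero j i hij.symm)]
    · have hs : s i = s j := by
        by_contra hne
        exact (hmono i j ⟨not_le.1 habs, Or.inl hne⟩).not_ge hle
      cases h : s i
      · have h1 := (hsneg i).1 h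
        have h2 := (hsneg j).1 (hs ▸ h)
        constructor <;> intro <;> linarith
      · have h1 := (hspos i).1 h
        have h2 := (hspos j).1 (hs ▸ h)
        constructor <;> intro <;> linarith
  · rw [← not_lt, ← hc, hspos]
    constructor
    · intro h
      exact ⟨fun h' => by linarith [(abs_lt.1 h').2], by linarith⟩
    · rintro ⟨h, hpos⟩
      simpa [abs_of_pos hpos] using hone i h
  · rw [← not_lt, ← hc, hsneg]
    constructor
    · intro h
      exact ⟨fun h' => by linarith [(abs_lt.1 h').1], by linarith⟩
    · rintro ⟨h, hneg⟩
      have := hone i h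
      rw [abs_of_neg hneg] at this
      linarith

end RegionCode

/-- A code is sent to the region of the point that it prescribes. -/
theorem exists_bijective_regionCode (n : ℕ) :
    ∃ F : RegionCode n → arrangementRegions (boxedThresholdArrangement n), Bijective F := by
  let p : RegionCode n → Fin n → ℝ := fun x i => (levelPoint x.level x.threshold x.sign i + 1) / 2
  have hp : ∀ x : RegionCode n,
      (fun i => 2 * p x i - 1) = levelPoint x.level x.threshold x.sign := fun x =>
    funext fun i => by simp only [p]; ring
  have hmem : ∀ x, p x ∈ (⋃₀ boxedThresholdArrangement n)ᶜ := fun x => by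
    rw [mem_compl_sUnion_boxedThresholdArrangement, hp]
    exact isGeneric_levelPoint x.sign_eq_of_level_eq
  have hrep : ∀ x : RegionCode n, Represents x.level x.threshold x.sign
      (levelPoint x.level x.threshold x.sign) := fun x =>
    represents_levelPoint x.sign_eq_of_level_eq
  refine ⟨fun x => ⟨_, p x, hmem x, rfl⟩, fun x y hxy => ?_, ?_⟩
  · have h := (connectedComponentIn_eq_iff_sameSide (hmem x) (hmem y)).1 (congrArg Subtype.val hxy)
    rw [hp, hp] at h
    exact RegionCode.eq_of_represents ((hrep x).congr h) (hrep y)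
  · rintro ⟨_, y, hy, rfl⟩
    obtain ⟨x, hx⟩ :=
      RegionCode.exists_represents (mem_compl_sUnion_boxedThresholdArrangement.1 hy)
    refine ⟨x, Subtype.ext ((connectedComponentIn_eq_iff_sameSide (hmem x) hy).2 ?_)⟩
    rw [hp]
    exact (hrep x).sameSide hx

theorem theorem3p10 (n : ℕ) (hn : 2 ≤ n) :
    (arrangementRegions (boxedThresholdArrangement n)).Finite ∧
    ((arrangementRegions (boxedThresholdArrangement n)).ncard : ℤ) =
      4 * (orderedBell n : ℤ) +
        ∑ k ∈ Finset.Icc 1 n,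
          4 * ((Nat.factorial k : ℤ) - (Nat.factorial (k - 1) : ℤ)) *
            ((k : ℤ) * (Nat.stirlingSecond n k : ℤ) -
              (n : ℤ) * (Nat.stirlingSecond (n - 1) (k - 1) : ℤ)) := by
  obtain ⟨F, hF⟩ := exists_bijective_regionCode n
  have : Finite (RegionCode n) := inferInstance
  have : Finite (arrangementRegions (boxedThresholdArrangement n)) := Finite.of_surjective F hF.2
  refine ⟨Set.toFinite _, ?_⟩
  rw [← Nat.card_coe_set_eq, ← Nat.card_eq_of_bijective F hF, card_regionCode hn]
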